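/- **Model.** There are $n$ FIFO queues in discrete time. In slot $t$, $A(t)\in\mathbb Z_+$ jobs arrive and are all sent to one queue $I^*(t)$; then queue $l$ serves up to $S_l(t)\in\mathbb Z_+$ jobs, so that $$Q_l(t+1)=[Q_l(t)+A(t)\mathbf 1\{l=I^*(t)\}-S_l(t)]^+ .$$ The pairs $(A(t),\mathbf S(t))$ are i.i.d. over $t$, with $E[A]=n\lambda$, $E[S_l]=\mu_l$, $A\le nA_{\max}$ and $S_l\le S_{\max}$ almost surely, and $0<\mu_{\min}\le\mu_l\le\mu_{\max}$ for all $l$. Under the $k$-SLQ-$d$ policy ($k\ge1$, $1\le d\le n-1$), at every slot $t$ that is a multiple of $k(n-d)$ the set $I_d$ of the $d$ longest queues is determined (ties broken uniformly at random), and during the $k(n-d)$ slots starting with $t$ arrivals are sent in Round-Robin order over the $n-d$ queues outside $I_d$. Let $\mathbf X(t)=(\mathbf Q(t),I_d(t),I_R(t),N_R(t))$ be the resulting Markov chain, where $I_R(t)=I^*(t)$ and $N_R(t)\in\{0,\dots,k-1\}$ is the number of completed rounds since the last sampling time, and let $\tilde{\mathbf Q}(t)=\mathbf Q(k(n-d)t)$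 be the sampled chain. For a queue length vector $\mathbf Q$ put $\mathbf Q_\perp=\mathbf Q-\langle\mathbf c,\mathbf Q\rangle\mathbf c$ with $\mathbf c=(1/\sqrt n,\dots,1/\sqrt n)$. **Theorem 2 (state space collapse).** For all constants $A_{\max},S_{\max}$ and $\delta>0$ there is a function $N_2(n,k,d)$ (depending on these three constants only, and in particular not on $\epsilon$) with $$N_2(n,k,d)\in\Theta\big(n^8(n-d)^2k^2\big)\quad\text{uniformly over all } k\ge 1,\ 1\le d\le n-1,$$ such that the following holds for every $k$-SLQ-$d$ system as above with bounds $A_{\max},S_{\max}$. Suppose that $$d>n-\sum_{l=1}^n\frac{\mu_l}{\max_j\mu_j},\qquad 0<\epsilon:=\sum_{l=1}^n\mu_l-n\lambda\le\frac12\min\Big\{\mu_{\min},\ \frac1{n-d}\sum_{i=1}^n\mu_i-\mu_{\max}\Big\},$$ and that the last minimum is at least $\delta$. Then $$E\big[\|\mathbf Q_\perp\|_2^2\big]\le N_2(n,k,d),$$ both when $\mathbf Q$ follows a stationary distribution of the sampled chain $\tilde{\mathbf Q}$ and when $\mathbf Q$ is the queue length component of a stationary distribution of $\mathbf X$. -/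

import Mathlib

open scoped ENNReal

noncomputable section

namespace SLQ

/-! Discrete-time system of `n` parallel queues under the `k`-SLQ-`d` policy. -/

/-- One time slot of the queue dynamics: `a` jobs join queue `i`, then queue `l` serves up to
`s l` jobs. Subtraction in `ℕ` is truncated at zero, so this is `[q + a e_i - s]⁺`. -/
def serve {n : ℕ} (q : Fin n → ℕ) (i : Fin n) (a : ℕ) (s : Fin n → ℕ) : Fin n → ℕ :=
  fun l => (q l + if l = i then a else 0) - s l

/-- The sets of `d` indices that can be called "the `d` longest queues" when the queue lengths
are `q` (there are several of them exactly if there are ties at the boundary). -/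
def longestSets {n : ℕ} (d : ℕ) (q : Fin n → ℕ) :
    Finset {T : Finset (Fin n) // T.card = d} :=
  Finset.univ.filter fun T => ∀ i ∈ T.1, ∀ j ∉ T.1, q j ≤ q i

theorem longestSets_nonempty {n d : ℕ} (hdn : d < n) (q : Fin n → ℕ) :
    (longestSets d q).Nonempty := by
  classical
  have hcard : ((Finset.univ.filter fun i : Fin n => n - d ≤ (i : ℕ)).map
      (Tuple.sort q).toEmbedding).card = d := by
    rw [Finset.card_map]
    have h := Fin.card_filter_val_lt (n := n) (m := n - d)
    have h2 := Finset.card_filter_add_card_filter_not (s := (Finset.univ : Finset (Fin n)))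
      (fun i : Fin n => (i : ℕ) < n - d)
    simp only [not_lt, Finset.card_univ, Fintype.card_fin] at h2
    rw [h] at h2
    omega
  refine ⟨⟨_, hcard⟩, ?_⟩
  simp only [longestSets, Finset.mem_filter, Finset.mem_univ, true_and]
  intro i hi j hj
  simp only [Finset.mem_map, Finset.mem_filter, Finset.mem_univ, true_and] at hi hj
  obtain ⟨a, ha, rfl⟩ := hi
  have hb : ¬ (n - d ≤ (((Tuple.sort q).symm j : Fin n) : ℕ)) := fun h =>
    hj ⟨_, h, by simp⟩
  have hle : (Tuple.sort q).symm j ≤ a := by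
    rw [Fin.le_def]; omega
  have := Tuple.monotone_sort q hle
  simpa using this

/-- The set of the `d` longest queues, ties being broken uniformly at random. -/
def chooseLongest {n d : ℕ} (hdn : d < n) (q : Fin n → ℕ) :
    PMF {T : Finset (Fin n) // T.card = d} :=
  PMF.uniformOfFinset (longestSets d q) (longestSets_nonempty hdn q)

/-- A state `(Q, I_d, I_R, N_R)` of the Markov chain. The index `I_R` of the queue that receives
the arrivals of the current slot is recorded through its position `pos` in the increasing
enumeration of the `n - d` indices outside `Id`; `round` is the number `N_R` of completed rounds
since the queue lengths were last sampled. -/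
structure State (n k d : ℕ) where
  Q : Fin n → ℕ
  Id : {T : Finset (Fin n) // T.card = d}
  pos : Fin (n - d)
  round : Fin k

/-- The index `I_R` of the queue to which the arrivals of the current slot are sent. -/
def State.IR {n k d : ℕ} (x : State n k d) : Fin n :=
  (x.Id.1)ᶜ.orderEmbOfFin (by rw [Finset.card_compl, Fintype.card_fin, x.Id.2]) x.pos

/-- The state just after the queue lengths have been sampled. -/
def State.start {n k d : ℕ} (hk : 1 ≤ k) (hdn : d < n) (q : Fin n → ℕ)
    (T : {T : Finset (Fin n) // T.card = d}) : State n k d :=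
  ⟨q, T, ⟨0, Nat.sub_pos_of_lt hdn⟩, ⟨0, hk⟩⟩

/-- One-slot transition law of the chain `X(t) = (Q(t), I_d(t), I_R(t), N_R(t))`, where `law` is
the law of the pair (number of arrivals, vector of potential services) of one slot. Fresh,
independent copies of this pair are used in different slots. -/
def step {n k d : ℕ} (hk : 1 ≤ k) (hdn : d < n) (law : PMF (ℕ × (Fin n → ℕ)))
    (x : State n k d) : PMF (State n k d) :=
  law.bind fun p =>
    if h : (x.pos : ℕ) + 1 < n - d then
      -- continue the current round
      PMF.pure ⟨serve x.Q x.IR p.1 p.2, x.Id, ⟨x.pos + 1, h⟩, x.round⟩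
    else if h' : (x.round : ℕ) + 1 < k then
      -- begin the next round over the same set of queues
      PMF.pure ⟨serve x.Q x.IR p.1 p.2, x.Id, ⟨0, Nat.sub_pos_of_lt hdn⟩, ⟨x.round + 1, h'⟩⟩
    else
      -- all `k` rounds are over: sample the queue lengths again
      (chooseLongest hdn (serve x.Q x.IR p.1 p.2)).map
        (State.start hk hdn (serve x.Q x.IR p.1 p.2))

/-- The `m`-step transition law of the chain with one-step transition law `κ`. -/
def iterStep {α : Type} (κ : α → PMF α) : ℕ → α → PMF α
  | 0, x => PMF.pure x
  | m + 1, x => (iterStep κ m x).bind κ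

/-- Transition law of the sampled chain of queue lengths, observed every `k (n - d)` slots. -/
def sampledStep {n k d : ℕ} (hk : 1 ≤ k) (hdn : d < n) (law : PMF (ℕ × (Fin n → ℕ)))
    (q : Fin n → ℕ) : PMF (Fin n → ℕ) :=
  (chooseLongest hdn q).bind fun T =>
    (iterStep (step hk hdn law) (k * (n - d)) (State.start hk hdn q T)).map State.Q

/-- `π` is a stationary (steady-state) distribution of the chain with transition law `κ`. -/
def IsStationary {α : Type} (κ : α → PMF α) (π : PMF α) : Prop :=
  π.bind κ = π

/-- The assumptions on arrivals and services: `A ≤ n A_max` and `S_l ≤ S_max` almost surely,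
`E[A] = n λ`, `E[S_l] = μ_l`, and `0 < μ_min ≤ μ_l ≤ μ_max`. -/
structure IsModel {n : ℕ} (law : PMF (ℕ × (Fin n → ℕ))) (Amax Smax lam : ℝ) (μ : Fin n → ℝ)
    (μmin μmax : ℝ) : Prop where
  arrival_le : ∀ p ∈ law.support, (p.1 : ℝ) ≤ n * Amax
  service_le : ∀ p ∈ law.support, ∀ l, (p.2 l : ℝ) ≤ Smax
  arrival_mean : HasSum (fun p => (law p).toReal * (p.1 : ℝ)) (n * lam)
  service_mean : ∀ l, HasSum (fun p => (law p).toReal * (p.2 l : ℝ)) (μ l)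
  μmin_pos : 0 < μmin
  μmin_le : ∀ l, μmin ≤ μ l
  le_μmax : ∀ l, μ l ≤ μmax

/-- The unit vector `c = (1/√n, …, 1/√n)`. -/
def cVec (n : ℕ) : EuclideanSpace ℝ (Fin n) :=
  WithLp.toLp 2 fun _ => 1 / Real.sqrt n

/-- The queue length vector as an element of Euclidean space. -/
def toVec {n : ℕ} (q : Fin n → ℕ) : EuclideanSpace ℝ (Fin n) :=
  WithLp.toLp 2 fun l => (q l : ℝ)

/-- Projection of the queue length vector onto the line spanned by `c`. -/
def parallel {n : ℕ} (q : Fin n → ℕ) : EuclideanSpace ℝ (Fin n) :=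
  inner ℝ (cVec n) (toVec q) • cVec n

/-- The perpendicular component of the queue length vector. -/
def perp {n : ℕ} (q : Fin n → ℕ) : EuclideanSpace ℝ (Fin n) :=
  toVec q - parallel q

/-- `E[‖Q_⊥‖₂²]` when the state has law `π` and `Q` reads off the queue lengths
(an element of `[0, ∞]`). -/
def perpSecondMoment {α : Type} {n : ℕ} (π : PMF α) (Q : α → Fin n → ℕ) : ℝ≥0∞ :=
  ∑' x, π x * ENNReal.ofReal (‖perp (Q x)‖ ^ 2)

end SLQ

end

noncomputable section

namespace SLQ

/-! ### Expectations under discrete laws, and drift bounds for stationary laws -/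

section Expectation

variable {α β : Type*}

/-! The Lyapunov function is `‖Q_⊥‖⁴`, observed over one sampling period of `K = k (n - d)` slots.
The set of longest queues is frozen during a period: its members are only served, while every other
queue receives exactly `k` slots of arrivals, in mean more than it serves. Measured against the
deviations from the mean queue length, the mean increment is therefore at most `-K (δ/2) ‖Q_⊥‖`
(`mean_increment_le`, `sum_route`), up to service wasted at empty queues. With `ρ` bounding the
arrivals of one slot and the services of one queue, this waste and the bound on the squared
increment are both `B = n (K ρ)²` (`expect_window_le`, `spread_sq_add_le`).

Hence `‖Q_⊥‖⁴` grows in mean by at most `-2δK ‖Q_⊥‖³ + 14 B ‖Q_⊥‖² + 2 B²`, which is at most a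
constant minus `B ‖Q_⊥‖²` (`expect_window_spread_sq_le`). The square as Lyapunov function would
control only the first moment; the fourth power gives the second, by `stationary_le_of_drift`.

For the full chain, a stationary state is run until the next sampling time. The queue lengths found
there are stationary for the sampled chain (`isStationary_nextSample`) and each has moved by at most
`K ρ`, which costs a factor 2 and a term `2 B` (`perpSecondMoment_le_nextSample`). -/

theorem tsum_bind_mul (p : PMF α) (κ : α → PMF β) (g : β → ℝ≥0∞) :
    ∑' y, (p.bind κ) y * g y = ∑' x, p x * ∑' y, κ x y * g y := by
  simp_rw [PMF.bind_apply, ← ENNReal.tsum_mul_right, ← ENNReal.tsum_mul_left]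
  rw [ENNReal.tsum_comm]
  simp_rw [mul_assoc]

theorem tsum_mul_mono {p : PMF α} {f g : α → ℝ≥0∞} (h : ∀ x ∈ p.support, f x ≤ g x) :
    ∑' x, p x * f x ≤ ∑' x, p x * g x := by
  refine ENNReal.tsum_le_tsum fun x => ?_
  by_cases hx : p x = 0
  · simp [hx]
  · gcongr
    exact h x ((PMF.mem_support_iff _ _).2 hx)

theorem tsum_mul_const (p : PMF α) (c : ℝ≥0∞) : ∑' x, p x * c = c := by
  rw [ENNReal.tsum_mul_right, p.tsum_coe, one_mul]

theorem tsum_mul_le_of_le {p : PMF α} {f : α → ℝ≥0∞} {c : ℝ≥0∞}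
    (h : ∀ x ∈ p.support, f x ≤ c) : ∑' x, p x * f x ≤ c :=
  (tsum_mul_mono h).trans (tsum_mul_const p c).le

theorem bind_congr_support {p : PMF α} {κ κ' : α → PMF β}
    (h : ∀ x ∈ p.support, κ x = κ' x) : p.bind κ = p.bind κ' := by
  ext y
  simp only [PMF.bind_apply]
  refine tsum_congr fun x => ?_
  by_cases hx : p x = 0
  · simp [hx]
  · rw [h x ((PMF.mem_support_iff _ _).2 hx)]

/-- A Foster–Lyapunov bound for stationary distributions, without any moment assumption. -/
theorem stationary_le_of_drift {α : Type} {κ : α → PMF α} {π : PMF α} (hπ : IsStationary κ π)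
    {V f : α → ℝ≥0∞} {b : ℝ≥0∞} (hV : ∀ x, V x ≠ ⊤)
    (hdrift : ∀ x, (∑' y, κ x y * V y) + f x ≤ V x + b) : ∑' x, π x * f x ≤ b := by
  set U : α → ℝ≥0∞ := fun x => ∑' y, κ x y * V y with hU
  -- `V` may have infinite mean under `π`, so stationarity is applied to the bounded function `min V
  -- M`, whose mean is finite and can be cancelled.
  have key : ∀ M : ℝ≥0∞, M ≠ ⊤ → ∑' x, π x * (if V x ≤ M then f x else 0) ≤ b := by
    intro M hM
    have h1 : ∑' x, π x * min (V x) M ≤ ∑' x, π x * min (U x) M := by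
      calc ∑' x, π x * min (V x) M = ∑' x, (π.bind κ) x * min (V x) M := by rw [hπ]
        _ = ∑' x, π x * ∑' y, κ x y * min (V y) M := tsum_bind_mul _ _ _
        _ ≤ ∑' x, π x * min (U x) M := by
          refine tsum_mul_mono fun x _ => le_min ?_ ?_
          · exact tsum_mul_mono fun y _ => min_le_left _ _
          · exact tsum_mul_le_of_le fun y _ => min_le_right _ _
    have hfin : ∑' x, π x * min (U x) M ≠ ⊤ :=
      ne_top_of_le_ne_top hM (tsum_mul_le_of_le fun y _ => min_le_right _ _)
    have h2 : (∑' x, π x * min (U x) M) + ∑' x, π x * (if V x ≤ M then f x else 0) ≤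
        (∑' x, π x * min (U x) M) + b := by
      calc _ = ∑' x, π x * (min (U x) M + if V x ≤ M then f x else 0) := by
            rw [← ENNReal.tsum_add]
            simp_rw [mul_add]
        _ ≤ ∑' x, π x * (min (V x) M + b) := by
            refine tsum_mul_mono fun x _ => ?_
            split_ifs with hx
            · rw [min_eq_left hx]
              exact (add_le_add_left (min_le_left _ _) _).trans (hdrift x)
            · rw [min_eq_right (not_le.1 hx).le, add_zero]
              exact (min_le_right _ _).trans le_self_add
        _ = (∑' x, π x * min (V x) M) + b := by
            simp_rw [mul_add]
            rw [ENNReal.tsum_add, tsum_mul_const]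
        _ ≤ _ := by gcongr
    exact (ENNReal.add_le_add_iff_left hfin).1 h2
  -- For a finite partial sum, the truncation level can be the maximum of `V` over it, so no term is
  -- lost.
  rw [ENNReal.tsum_eq_iSup_sum]
  refine iSup_le fun s => ?_
  have hM : s.sup V ≠ ⊤ := by
    rw [← lt_top_iff_ne_top, Finset.sup_lt_iff (by simp)]
    exact fun x _ => lt_top_iff_ne_top.2 (hV x)
  calc ∑ x ∈ s, π x * f x = ∑ x ∈ s, π x * (if V x ≤ s.sup V then f x else 0) :=
        Finset.sum_congr rfl fun x hx => by rw [if_pos (Finset.le_sup hx)]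
    _ ≤ ∑' x, π x * (if V x ≤ s.sup V then f x else 0) := ENNReal.sum_le_tsum s
    _ ≤ b := key _ hM

/-- The expectation of a real function under a discrete distribution. -/
def expect (p : PMF α) (f : α → ℝ) : ℝ := ∑' x, (p x).toReal * f x

theorem summable_expect {p : PMF α} (hp : p.support.Finite) (f : α → ℝ) :
    Summable fun x => (p x).toReal * f x := by
  refine summable_of_ne_finset_zero (s := hp.toFinset) fun x hx => ?_
  rw [Set.Finite.mem_toFinset, PMF.mem_support_iff, not_not] at hx
  simp [hx]

/-- Passage between `[0, ∞]`, where no moment has to be assumed finite, and `ℝ`, where the drift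
computation needs signed terms. -/
theorem tsum_mul_ofReal {p : PMF α} (hp : p.support.Finite) {f : α → ℝ} (hf : ∀ x, 0 ≤ f x) :
    ∑' x, p x * ENNReal.ofReal (f x) = ENNReal.ofReal (expect p f) := by
  rw [expect, ENNReal.ofReal_tsum_of_nonneg
    (fun x => mul_nonneg ENNReal.toReal_nonneg (hf x)) (summable_expect hp f)]
  refine tsum_congr fun x => ?_
  rw [ENNReal.ofReal_mul ENNReal.toReal_nonneg, ENNReal.ofReal_toReal (p.apply_ne_top x)]

theorem expect_const (p : PMF α) (c : ℝ) : expect p (fun _ => c) = c := by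
  rw [expect, tsum_mul_right, ← ENNReal.tsum_toReal_eq fun x => p.apply_ne_top x, p.tsum_coe]
  simp

theorem expect_add {p : PMF α} (hp : p.support.Finite) (f g : α → ℝ) :
    expect p (fun x => f x + g x) = expect p f + expect p g := by
  rw [expect, expect, expect, ← (summable_expect hp f).tsum_add (summable_expect hp g)]
  simp_rw [mul_add]

theorem expect_const_mul (p : PMF α) (c : ℝ) (f : α → ℝ) :
    expect p (fun x => c * f x) = c * expect p f := by
  rw [expect, expect, ← tsum_mul_left]
  exact tsum_congr fun x => by ring

theorem expect_sum {ι : Type*} {p : PMF α} (hp : p.support.Finite) (s : Finset ι)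
    (f : ι → α → ℝ) : expect p (fun x => ∑ i ∈ s, f i x) = ∑ i ∈ s, expect p (f i) := by
  simp only [expect, Finset.mul_sum]
  exact Summable.tsum_finsetSum fun i _ => summable_expect hp (f i)

theorem expect_mono {p : PMF α} (hp : p.support.Finite) {f g : α → ℝ}
    (h : ∀ x ∈ p.support, f x ≤ g x) : expect p f ≤ expect p g := by
  refine Summable.tsum_le_tsum (fun x => ?_) (summable_expect hp f) (summable_expect hp g)
  by_cases hx : p x = 0
  · simp [hx]
  · exact mul_le_mul_of_nonneg_left (h x ((PMF.mem_support_iff _ _).2 hx)) ENNReal.toReal_nonneg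

theorem expect_pure (a : α) (f : α → ℝ) : expect (PMF.pure a) f = f a := by
  rw [expect, tsum_eq_single a]
  · simp
  · intro b hb
    simp [PMF.pure_apply, hb]

theorem support_bind_finite {p : PMF α} {κ : α → PMF β} (hp : p.support.Finite)
    (hκ : ∀ x, (κ x).support.Finite) : (p.bind κ).support.Finite := by
  rw [PMF.support_bind]
  exact hp.biUnion fun x _ => hκ x

theorem expect_bind {p : PMF α} {κ : α → PMF β} (hp : p.support.Finite)
    (hκ : ∀ x, (κ x).support.Finite) (f : β → ℝ) :
    expect (p.bind κ) f = expect p fun x => expect (κ x) f := by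
  have hκs := support_bind_finite hp hκ
  have hsub : ∀ x ∈ p.support, ∀ y ∉ hκs.toFinset, κ x y = 0 := by
    intro x hx y hy
    by_contra h
    exact hy (hκs.mem_toFinset.2 ((PMF.mem_support_bind_iff _ _ _).2
      ⟨x, hx, (PMF.mem_support_iff _ _).2 h⟩))
  have h0 : ∀ x ∉ hp.toFinset, p x = 0 := by
    intro x hx
    rwa [Set.Finite.mem_toFinset, PMF.mem_support_iff, not_not] at hx
  have hL : expect (p.bind κ) f = ∑ y ∈ hκs.toFinset, ∑ x ∈ hp.toFinset,
      (p x).toReal * ((κ x y).toReal * f y) := by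
    rw [expect, tsum_eq_sum (s := hκs.toFinset)]
    · refine Finset.sum_congr rfl fun y _ => ?_
      rw [PMF.bind_apply, tsum_eq_sum (s := hp.toFinset) (fun x hx => by simp [h0 x hx]),
        ENNReal.toReal_sum (fun x _ => ENNReal.mul_ne_top (p.apply_ne_top x)
          ((κ x).apply_ne_top y)), Finset.sum_mul]
      simp_rw [ENNReal.toReal_mul, mul_assoc]
    · intro y hy
      rw [Set.Finite.mem_toFinset, PMF.mem_support_iff, not_not] at hy
      simp [hy]
  rw [hL, Finset.sum_comm, expect, tsum_eq_sum (s := hp.toFinset) (fun x hx => by simp [h0 x hx])]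
  refine Finset.sum_congr rfl fun x hx => ?_
  rw [expect, tsum_eq_sum (s := hκs.toFinset) (fun y hy => by
    simp [hsub x (hp.mem_toFinset.1 hx) y hy]), Finset.mul_sum]

theorem expect_map {p : PMF α} (hp : p.support.Finite) (h : α → β) (f : β → ℝ) :
    expect (p.map h) f = expect p fun x => f (h x) := by
  rw [PMF.map, expect_bind hp fun x => by simp [Function.comp, PMF.support_pure]]
  simp [expect_pure]

end Expectation

/-! ### Structure of the chain: periods, phases and the next sampling time -/

section Chain

variable {n k d : ℕ}

/-- The queue that receives the arrivals in slot `j` after a sampling time that gave `T`. -/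
def route (hdn : d < n) (T : {T : Finset (Fin n) // T.card = d}) (j : ℕ) : Fin n :=
  (T.1)ᶜ.orderEmbOfFin (by rw [Finset.card_compl, Fintype.card_fin, T.2])
    ⟨j % (n - d), Nat.mod_lt _ (Nat.sub_pos_of_lt hdn)⟩

/-- One-slot transition law of the queue lengths when arrivals join queue `i`. -/
def slot (law : PMF (ℕ × (Fin n → ℕ))) (i : Fin n) (q : Fin n → ℕ) : PMF (Fin n → ℕ) :=
  law.map fun p => serve q i p.1 p.2

/-- Law of the queue lengths `j` slots after a sampling time that gave `T`. -/
def window (law : PMF (ℕ × (Fin n → ℕ))) (hdn : d < n) (T : {T : Finset (Fin n) // T.card = d})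
    (q : Fin n → ℕ) : ℕ → PMF (Fin n → ℕ)
  | 0 => PMF.pure q
  | j + 1 => (window law hdn T q j).bind (slot law (route hdn T j))

/-- The state `j` slots after a sampling time that gave `T`. -/
def State.mid (hdn : d < n) (T : {T : Finset (Fin n) // T.card = d}) (j : ℕ)
    (hj : j < k * (n - d)) (q : Fin n → ℕ) : State n k d :=
  ⟨q, T, ⟨j % (n - d), Nat.mod_lt _ (Nat.sub_pos_of_lt hdn)⟩,
    ⟨j / (n - d), Nat.div_lt_of_lt_mul (by rwa [mul_comm])⟩⟩

/-- The number of slots since the last sampling time. -/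
def State.phase (x : State n k d) : ℕ := x.pos + (n - d) * x.round

theorem State.phase_lt (x : State n k d) : x.phase < k * (n - d) := by
  have h1 := x.pos.2
  have h2 : (n - d) * (x.round + 1) ≤ (n - d) * k := Nat.mul_le_mul_left _ x.round.2
  rw [State.phase, mul_comm k]
  rw [mul_add, mul_one] at h2
  omega

theorem State.phase_mid (hdn : d < n) (T : {T : Finset (Fin n) // T.card = d}) (j : ℕ)
    (hj : j < k * (n - d)) (q : Fin n → ℕ) : (State.mid hdn T j hj q).phase = j :=
  Nat.mod_add_div _ _

theorem State.mid_phase (hdn : d < n) (x : State n k d) :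
    State.mid hdn x.Id x.phase x.phase_lt x.Q = x := by
  have hm : 0 < n - d := Nat.sub_pos_of_lt hdn
  obtain ⟨q, T, ⟨a, ha⟩, ⟨r, hr⟩⟩ := x
  simp [State.mid, State.phase, Nat.add_mul_div_left _ _ hm, Nat.mod_eq_of_lt ha,
    Nat.div_eq_of_lt ha]

theorem State.start_eq_mid (hk : 1 ≤ k) (hdn : d < n)
    (T : {T : Finset (Fin n) // T.card = d}) (q : Fin n → ℕ) :
    State.start hk hdn q T =
      State.mid hdn T 0 (Nat.mul_pos hk (Nat.sub_pos_of_lt hdn)) q := by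
  simp [State.start, State.mid]

variable (law : PMF (ℕ × (Fin n → ℕ)))

/-- The law of the state after sampling the queue lengths `q`. -/
def resample (hk : 1 ≤ k) (hdn : d < n) (q : Fin n → ℕ) : PMF (State n k d) :=
  (chooseLongest hdn q).map (State.start hk hdn q)

/-- Position and round are the remainder and quotient of the phase by `n - d`, so both non-sampling
branches of `step` just increase the phase by one, with or without a carry. -/
theorem step_mid (hk : 1 ≤ k) (hdn : d < n) (T : {T : Finset (Fin n) // T.card = d}) {j : ℕ}
    (hj : j + 1 < k * (n - d)) (q : Fin n → ℕ) :
    step hk hdn law (State.mid hdn T j (by omega) q) =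
      (slot law (route hdn T j) q).map (State.mid hdn T (j + 1) hj) := by
  have hm : 0 < n - d := Nat.sub_pos_of_lt hdn
  have hIR : (State.mid hdn T j (by omega) q : State n k d).IR = route hdn T j := rfl
  rw [slot, PMF.map_comp, step, PMF.map]
  congr 1
  funext p
  rw [hIR]
  have hdiv := Nat.mod_add_div j (n - d)
  by_cases h : j % (n - d) + 1 < n - d
  · have e1 : (j + 1) % (n - d) = j % (n - d) + 1 := by
      conv_lhs => rw [← hdiv, add_right_comm, Nat.add_mul_mod_self_left, Nat.mod_eq_of_lt h]
    have e2 : (j + 1) / (n - d) = j / (n - d) := by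
      conv_lhs => rw [← hdiv, add_right_comm, Nat.add_mul_div_left _ _ hm, Nat.div_eq_of_lt h,
        zero_add]
    rw [dif_pos (by exact h)]
    simp only [Function.comp, State.mid, e1, e2]
  · have h' : j % (n - d) + 1 = n - d := by
      have := Nat.mod_lt j hm
      omega
    have e0 : j + 1 = (n - d) * (j / (n - d) + 1) := by
      rw [mul_add, mul_one]
      omega
    have e1 : (j + 1) % (n - d) = 0 := by
      rw [e0, Nat.mul_mod_right]
    have e2 : (j + 1) / (n - d) = j / (n - d) + 1 := by
      conv_lhs => rw [e0, Nat.mul_div_cancel_left _ hm]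
    have h2 : j / (n - d) + 1 < k := by
      rw [← e2]
      exact Nat.div_lt_of_lt_mul (by rwa [mul_comm])
    rw [dif_neg (by exact h), dif_pos (by exact h2)]
    simp only [Function.comp, State.mid, e1, e2]

theorem step_mid_last (hk : 1 ≤ k) (hdn : d < n) (T : {T : Finset (Fin n) // T.card = d}) {j : ℕ}
    (hj : j + 1 = k * (n - d)) (q : Fin n → ℕ) :
    step hk hdn law (State.mid hdn T j (by omega) q) =
      (slot law (route hdn T j) q).bind (resample hk hdn) := by
  have hm : 0 < n - d := Nat.sub_pos_of_lt hdn
  have hIR : (State.mid hdn T j (by omega) q : State n k d).IR = route hdn T j := rfl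
  rw [slot, PMF.bind_map, step]
  congr 1
  funext p
  rw [hIR]
  have hdiv := Nat.mod_add_div j (n - d)
  have h1 : n - d ∣ j + 1 := hj ▸ Dvd.intro_left _ rfl
  have h2 : ¬ j % (n - d) + 1 < n - d := by
    intro h
    have e1 : (j + 1) % (n - d) = j % (n - d) + 1 := by
      conv_lhs => rw [← hdiv, add_right_comm, Nat.add_mul_mod_self_left, Nat.mod_eq_of_lt h]
    rw [Nat.mod_eq_zero_of_dvd h1] at e1
    omega
  have h3 : ¬ j / (n - d) + 1 < k := by
    intro h
    have h4 : (n - d) * (j / (n - d) + 1 + 1) ≤ (n - d) * k := Nat.mul_le_mul_left _ h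
    have := Nat.mod_lt j hm
    rw [mul_comm k] at hj
    rw [mul_add, mul_add, mul_one] at h4
    omega
  rw [dif_neg (by exact h2), dif_neg (by exact h3)]
  rfl

theorem map_Q_resample (hk : 1 ≤ k) (hdn : d < n) (q : Fin n → ℕ) :
    (resample hk hdn q).map State.Q = PMF.pure q := by
  rw [resample, PMF.map_comp]
  exact PMF.map_const _ _

theorem map_Q_step_mid (hk : 1 ≤ k) (hdn : d < n) (T : {T : Finset (Fin n) // T.card = d}) {j : ℕ}
    (hj : j < k * (n - d)) (q : Fin n → ℕ) :
    (step hk hdn law (State.mid hdn T j hj q)).map State.Q = slot law (route hdn T j) q := by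
  rcases Nat.lt_or_ge (j + 1) (k * (n - d)) with h | h
  · rw [step_mid law hk hdn T h, PMF.map_comp]
    exact PMF.map_id _
  · rw [step_mid_last law hk hdn T (by omega), PMF.map_bind]
    simp_rw [map_Q_resample]
    exact PMF.bind_pure _

/-- In the last slot of a period the new set, position and round depend on the past only through the
new queue lengths, so the step factors through them. -/
theorem step_eq_of_last (hk : 1 ≤ k) (hdn : d < n) {x : State n k d}
    (hx : x.phase + 1 = k * (n - d)) :
    step hk hdn law x = ((step hk hdn law x).map State.Q).bind (resample hk hdn) := by
  conv_rhs => rw [← State.mid_phase hdn x, map_Q_step_mid]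
  conv_lhs => rw [← State.mid_phase hdn x]
  exact step_mid_last law hk hdn x.Id hx x.Q

theorem phase_step (hk : 1 ≤ k) (hdn : d < n) {x y : State n k d}
    (hy : y ∈ (step hk hdn law x).support) : y.phase = (x.phase + 1) % (k * (n - d)) := by
  have hx := x.phase_lt
  rw [← State.mid_phase hdn x] at hy
  rcases Nat.lt_or_ge (x.phase + 1) (k * (n - d)) with h | h
  · rw [step_mid law hk hdn x.Id h, PMF.mem_support_map_iff] at hy
    obtain ⟨q, -, rfl⟩ := hy
    rw [State.phase_mid, Nat.mod_eq_of_lt h]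
  · have h' : x.phase + 1 = k * (n - d) := by omega
    rw [step_mid_last law hk hdn x.Id h', PMF.mem_support_bind_iff] at hy
    obtain ⟨q, -, hq⟩ := hy
    rw [resample, PMF.mem_support_map_iff] at hq
    obtain ⟨T, -, rfl⟩ := hq
    rw [State.start_eq_mid, State.phase_mid, h', Nat.mod_self]

theorem phase_iterStep (hk : 1 ≤ k) (hdn : d < n) (m : ℕ) {x y : State n k d}
    (hy : y ∈ (iterStep (step hk hdn law) m x).support) :
    y.phase = (x.phase + m) % (k * (n - d)) := by
  induction m generalizing y with
  | zero =>
    rw [iterStep, PMF.mem_support_pure_iff] at hy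
    rw [hy, add_zero, Nat.mod_eq_of_lt x.phase_lt]
  | succ m ih =>
    rw [iterStep, PMF.mem_support_bind_iff] at hy
    obtain ⟨z, hz, hzy⟩ := hy
    rw [phase_step law hk hdn hzy, ih hz, Nat.mod_add_mod, add_assoc]

/-- Within a period the set is frozen and the phase is deterministic, so all randomness sits in the
queue lengths. -/
theorem iterStep_start (hk : 1 ≤ k) (hdn : d < n) (T : {T : Finset (Fin n) // T.card = d})
    (q : Fin n → ℕ) {j : ℕ} (hj : j < k * (n - d)) :
    iterStep (step hk hdn law) j (State.start hk hdn q T) =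
      (window law hdn T q j).map (State.mid hdn T j hj) := by
  induction j with
  | zero => rw [iterStep, window, PMF.pure_map, State.start_eq_mid]
  | succ j ih =>
    rw [iterStep, ih (by omega), window, PMF.bind_map, PMF.map_bind]
    congr 1
    funext q'
    exact step_mid law hk hdn T hj q'

theorem map_Q_iterStep_start (hk : 1 ≤ k) (hdn : d < n) (T : {T : Finset (Fin n) // T.card = d})
    (q : Fin n → ℕ) {j : ℕ} (hj : j ≤ k * (n - d)) :
    (iterStep (step hk hdn law) j (State.start hk hdn q T)).map State.Q =
      window law hdn T q j := by
  cases j with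
  | zero => rw [iterStep, PMF.pure_map, window]; rfl
  | succ j =>
    rw [iterStep, iterStep_start law hk hdn T q (by omega), PMF.bind_map, PMF.map_bind, window]
    congr 1
    funext q'
    exact map_Q_step_mid law hk hdn T (by omega) q'

theorem sampledStep_eq (hk : 1 ≤ k) (hdn : d < n) (q : Fin n → ℕ) :
    sampledStep hk hdn law q =
      (chooseLongest hdn q).bind fun T => window law hdn T q (k * (n - d)) := by
  rw [sampledStep]
  congr 1
  funext T
  exact map_Q_iterStep_start law hk hdn T q le_rfl

theorem sampledStep_eq_resample (hk : 1 ≤ k) (hdn : d < n) (q : Fin n → ℕ) :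
    sampledStep hk hdn law q =
      ((resample hk hdn q).bind (iterStep (step hk hdn law) (k * (n - d)))).map State.Q := by
  rw [sampledStep, resample, PMF.bind_map, PMF.map_bind]
  rfl

theorem iterStep_add {α : Type} (κ : α → PMF α) (a b : ℕ) (x : α) :
    iterStep κ (a + b) x = (iterStep κ a x).bind (iterStep κ b) := by
  induction b with
  | zero => exact (PMF.bind_pure _).symm
  | succ b ih =>
    rw [← add_assoc, iterStep, ih, PMF.bind_bind]
    rfl

theorem IsStationary.iterStep {α : Type} {κ : α → PMF α} {π : PMF α} (hπ : IsStationary κ π)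
    (m : ℕ) : π.bind (iterStep κ m) = π := by
  induction m with
  | zero => exact PMF.bind_pure _
  | succ m ih =>
    have h : π.bind (SLQ.iterStep κ (m + 1)) = (π.bind (SLQ.iterStep κ m)).bind κ := by
      rw [PMF.bind_bind]
      rfl
    rw [h, ih, hπ]

/-- The law of the queue lengths at the next sampling time. -/
def nextSample (hk : 1 ≤ k) (hdn : d < n) (x : State n k d) : PMF (Fin n → ℕ) :=
  (iterStep (step hk hdn law) (k * (n - d) - x.phase) x).map State.Q

/-- The final slot before the sampling time is the only one that draws a new set, and it does so
from the queue lengths alone; forgetting and redrawing the rest of the state changes nothing. -/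
theorem nextSample_bind_resample (hk : 1 ≤ k) (hdn : d < n) (x : State n k d) :
    (nextSample law hk hdn x).bind (resample hk hdn) =
      iterStep (step hk hdn law) (k * (n - d) - x.phase) x := by
  have hx := x.phase_lt
  -- At least one slot always remains: from phase 0 the next sampling time is a whole period away.
  obtain ⟨m, hm⟩ : ∃ m, k * (n - d) - x.phase = m + 1 := ⟨k * (n - d) - x.phase - 1, by omega⟩
  rw [nextSample, hm, iterStep, PMF.map_bind, PMF.bind_bind]
  refine bind_congr_support fun y hy => (step_eq_of_last law hk hdn ?_).symm
  rw [phase_iterStep law hk hdn m hy, Nat.mod_eq_of_lt (by omega)]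
  omega

/-- Both sides run the chain until the second sampling time from now. A full period leaves the phase
unchanged, so it may come before or after the wait for a sampling time. -/
theorem nextSample_bind_sampledStep (hk : 1 ≤ k) (hdn : d < n) (x : State n k d) :
    (nextSample law hk hdn x).bind (sampledStep hk hdn law) =
      (iterStep (step hk hdn law) (k * (n - d)) x).bind (nextSample law hk hdn) := by
  have hx := x.phase_lt
  have h : (nextSample law hk hdn x).bind (sampledStep hk hdn law) =
      (((nextSample law hk hdn x).bind (resample hk hdn)).bind
        (iterStep (step hk hdn law) (k * (n - d)))).map State.Q := by
    rw [PMF.bind_bind, PMF.map_bind]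
    congr 1
    funext q
    exact sampledStep_eq_resample law hk hdn q
  rw [h, nextSample_bind_resample, ← iterStep_add, add_comm, iterStep_add, PMF.map_bind]
  refine bind_congr_support fun y hy => ?_
  rw [nextSample, phase_iterStep law hk hdn _ hy, Nat.add_mod_right, Nat.mod_eq_of_lt hx]

/-- If the chain is stationary, then so are the queue lengths at the next sampling time. -/
theorem isStationary_nextSample (hk : 1 ≤ k) (hdn : d < n) {π : PMF (State n k d)}
    (hπ : IsStationary (step hk hdn law) π) :
    IsStationary (sampledStep hk hdn law) (π.bind (nextSample law hk hdn)) := by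
  rw [IsStationary, PMF.bind_bind]
  simp_rw [nextSample_bind_sampledStep]
  rw [← PMF.bind_bind, hπ.iterStep]

end Chain

/-! ### Squared deviation from the mean -/

section Spread

variable {n : ℕ}

/-- The sum of the squared deviations from the mean. -/
def spread (v : Fin n → ℝ) : ℝ := ∑ l, (v l - (∑ j, v j) / n) ^ 2

theorem spread_nonneg (v : Fin n → ℝ) : 0 ≤ spread v := Finset.sum_nonneg fun _ _ => sq_nonneg _

theorem norm_perp_sq (q : Fin n → ℕ) : ‖perp q‖ ^ 2 = spread fun l => (q l : ℝ) := by
  rw [EuclideanSpace.real_norm_sq_eq, spread]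
  refine Finset.sum_congr rfl fun l _ => ?_
  have hinner : inner ℝ (cVec n) (toVec q) = (∑ j, (q j : ℝ)) / Real.sqrt n := by
    rw [PiLp.inner_apply, Finset.sum_div]
    refine Finset.sum_congr rfl fun j _ => ?_
    simp [cVec, toVec, div_eq_mul_inv]
  have hs : Real.sqrt n * Real.sqrt n = n := Real.mul_self_sqrt n.cast_nonneg
  have : perp q l = (q l : ℝ) - (∑ j, (q j : ℝ)) / n := by
    rw [perp, parallel, hinner]
    simp only [toVec, cVec, PiLp.sub_apply, PiLp.smul_apply, smul_eq_mul]
    rw [div_mul_div_comm, mul_one, hs]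
  rw [this]

theorem sum_sub_mean (hn : 0 < n) (v : Fin n → ℝ) : ∑ l, (v l - (∑ j, v j) / n) = 0 := by
  have : (n : ℝ) ≠ 0 := by positivity
  rw [Finset.sum_sub_distrib, Finset.sum_const, Finset.card_univ, Fintype.card_fin, nsmul_eq_mul]
  field_simp
  ring

/-- The deviations of `v` sum to zero, so `w` need not be centred in the cross term. -/
theorem spread_add (hn : 0 < n) (v w : Fin n → ℝ) :
    spread (fun l => v l + w l) =
      spread v + 2 * (∑ l, (v l - (∑ j, v j) / n) * w l) + spread w := by
  have h : ∑ l, (v l - (∑ j, v j) / n) * w l =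
      ∑ l, (v l - (∑ j, v j) / n) * (w l - (∑ j, w j) / n) := by
    simp_rw [mul_sub]
    rw [Finset.sum_sub_distrib, ← Finset.sum_mul, sum_sub_mean hn, zero_mul, sub_zero]
  rw [h, spread, spread, spread, Finset.mul_sum, ← Finset.sum_add_distrib,
    ← Finset.sum_add_distrib]
  refine Finset.sum_congr rfl fun l _ => ?_
  rw [Finset.sum_add_distrib]
  ring

/-- The mean minimizes the sum of squared distances to a point. -/
theorem spread_le_sum_sq_sub (hn : 0 < n) (v : Fin n → ℝ) (θ : ℝ) :
    spread v ≤ ∑ l, (v l - θ) ^ 2 := by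
  have h : ∑ l, (v l - θ) ^ 2 = spread v + n * ((∑ j, v j) / n - θ) ^ 2 := by
    have h1 : ∀ l, (v l - θ) ^ 2 = (v l - (∑ j, v j) / n) ^ 2 +
        2 * ((∑ j, v j) / n - θ) * (v l - (∑ j, v j) / n) + ((∑ j, v j) / n - θ) ^ 2 :=
      fun l => by ring
    simp_rw [h1]
    rw [Finset.sum_add_distrib, Finset.sum_add_distrib, ← Finset.mul_sum, sum_sub_mean hn]
    simp [spread]
  rw [h]
  have : 0 ≤ (n : ℝ) * ((∑ j, v j) / n - θ) ^ 2 := by positivity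
  linarith

theorem sqrt_spread_le (hn : 0 < n) (v : Fin n → ℝ) (θ : ℝ) :
    Real.sqrt (spread v) ≤ ∑ l, |v l - θ| := by
  refine Real.sqrt_le_iff.2 ⟨Finset.sum_nonneg fun _ _ => abs_nonneg _, ?_⟩
  refine (spread_le_sum_sq_sub hn v θ).trans ?_
  have := Finset.sum_sq_le_sq_sum_of_nonneg (s := Finset.univ) (f := fun l => |v l - θ|)
    fun _ _ => abs_nonneg _
  simpa [sq_abs] using this

theorem spread_le_of_abs_le (hn : 0 < n) {v : Fin n → ℝ} {L : ℝ} (h : ∀ l, |v l| ≤ L) :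
    spread v ≤ n * L ^ 2 := by
  refine (spread_le_sum_sq_sub hn v 0).trans ?_
  calc ∑ l, (v l - 0) ^ 2 ≤ ∑ _l : Fin n, L ^ 2 := by
        refine Finset.sum_le_sum fun l _ => ?_
        rw [sub_zero, ← sq_abs]
        exact pow_le_pow_left₀ (abs_nonneg _) (h l) 2
    _ = n * L ^ 2 := by simp

theorem spread_sq_add_le (hn : 0 < n) {v w : Fin n → ℝ} {L : ℝ} (h : ∀ l, |w l| ≤ L) :
    spread (fun l => v l + w l) ^ 2 ≤
      spread v ^ 2 + 4 * spread v * (∑ l, (v l - (∑ j, v j) / n) * w l) +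
        10 * spread v * (n * L ^ 2) + 2 * (n * L ^ 2) ^ 2 := by
  rw [spread_add hn]
  set P := ∑ l, (v l - (∑ j, v j) / n) * w l with hP
  have hG := spread_le_of_abs_le hn h
  have hG0 := spread_nonneg w
  have hS := spread_nonneg v
  have hPP : P ^ 2 ≤ spread v * (n * L ^ 2) := by
    refine (Finset.sum_mul_sq_le_sq_mul_sq _ _ _).trans ?_
    refine mul_le_mul_of_nonneg_left ?_ hS
    calc ∑ l, w l ^ 2 ≤ ∑ _l : Fin n, L ^ 2 := by
          refine Finset.sum_le_sum fun l _ => ?_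
          rw [← sq_abs]
          exact pow_le_pow_left₀ (abs_nonneg _) (h l) 2
      _ = n * L ^ 2 := by simp
  set S := spread v
  set G := spread w
  set B := (n : ℝ) * L ^ 2
  have h1 : S * G ≤ S * B := mul_le_mul_of_nonneg_left hG hS
  have h2 : G ^ 2 ≤ B ^ 2 := pow_le_pow_left₀ hG0 hG 2
  -- In `(S + 2P + G)²`, the hint gives `4PG ≤ 4P² + G²`; then `8P² ≤ 8SB` by Cauchy–Schwarz and
  -- `2SG ≤ 2SB` make `10SB`.
  nlinarith [sq_nonneg (2 * P - G)]

theorem spread_add_le (hn : 0 < n) {v w : Fin n → ℝ} {L : ℝ} (h : ∀ l, |w l| ≤ L) :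
    spread (fun l => v l + w l) ≤ 2 * spread v + 2 * (n * L ^ 2) := by
  refine le_trans ?_ (add_le_add_right (mul_le_mul_of_nonneg_left
    (spread_le_of_abs_le hn h) zero_le_two) _)
  rw [spread, spread, spread, Finset.mul_sum, Finset.mul_sum, ← Finset.sum_add_distrib]
  refine Finset.sum_le_sum fun l _ => ?_
  rw [Finset.sum_add_distrib, add_div]
  nlinarith [sq_nonneg ((v l - (∑ j, v j) / n) - (w l - (∑ j, w j) / n))]

/-- The mean increment over a sampling period points towards equal queue lengths. -/
theorem mean_increment_le (hn : 0 < n) {T : Finset (Fin n)} {v μ : Fin n → ℝ} {θ a m δ μmin : ℝ}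
    (hm : 0 < m) (hcard : ((Tᶜ.card : ℕ) : ℝ) = m)
    (hθT : ∀ i ∈ T, θ ≤ v i) (hθ : ∀ i ∉ T, v i ≤ θ) (hδ : δ ≤ μmin) (hδ0 : 0 < δ)
    (hμ : ∀ l, μmin ≤ μ l) (hε : 0 < (∑ l, μ l) - a) (hε' : (∑ l, μ l) - a ≤ μmin / 2)
    (ha : ∀ l, μ l + δ / 2 ≤ a / m) :
    (a / m) * (∑ l ∈ Tᶜ, (v l - (∑ j, v j) / n)) - ∑ l, (v l - (∑ j, v j) / n) * μ l ≤
      -(δ / 2) * Real.sqrt (spread v) := by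
  classical
  set ε := (∑ l, μ l) - a with hεdef
  have hn' : (1 : ℝ) ≤ n := by exact_mod_cast hn
  have hεn : ε / n ≤ μmin / 2 := (div_le_self hε.le hn').trans hε'
  have hεn0 : 0 < ε / n := by positivity
  set ν : Fin n → ℝ := fun l => (if l ∈ Tᶜ then a / m else 0) - μ l with hν
  have hνsum : ∑ l, ν l = -ε := by
    rw [hν, Finset.sum_sub_distrib, Finset.sum_ite_mem, Finset.univ_inter, Finset.sum_const,
      nsmul_eq_mul, hcard, mul_div_cancel₀ _ hm.ne']
    ring
  have hmean : (∑ j, v j) / n - θ = (∑ l, (v l - θ)) / n := by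
    rw [Finset.sum_sub_distrib, Finset.sum_const, Finset.card_univ, Fintype.card_fin,
      nsmul_eq_mul]
    field_simp
  -- Since `ν` sums to `-ε`, adding `ε / n` makes it sum to zero, and the mean can be replaced by
  -- the threshold `θ` that separates `T` from its complement.
  have heq : (a / m) * (∑ l ∈ Tᶜ, (v l - (∑ j, v j) / n)) - ∑ l, (v l - (∑ j, v j) / n) * μ l =
      ∑ l, (v l - θ) * (ν l + ε / n) := by
    have h1 : (a / m) * (∑ l ∈ Tᶜ, (v l - (∑ j, v j) / n)) -
        ∑ l, (v l - (∑ j, v j) / n) * μ l = ∑ l, (v l - (∑ j, v j) / n) * ν l := by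
      rw [Finset.mul_sum, ← Finset.univ_inter Tᶜ, ← Finset.sum_ite_mem, ← Finset.sum_sub_distrib]
      refine Finset.sum_congr rfl fun l _ => ?_
      simp only [hν]
      split_ifs <;> ring
    have h2 : ∀ l, (v l - (∑ j, v j) / n) * ν l =
        (v l - θ) * ν l - ((∑ j, v j) / n - θ) * ν l := fun l => by ring
    rw [h1]
    simp_rw [h2, mul_add]
    rw [Finset.sum_sub_distrib, ← Finset.mul_sum, hνsum, Finset.sum_add_distrib, ← Finset.sum_mul,
      hmean]
    ring
  rw [heq]
  -- The two factors have opposite signs in every coordinate: on `T` the second is at most `-μmin /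
  -- 2`, off `T` it is at least `δ / 2`.
  calc ∑ l, (v l - θ) * (ν l + ε / n) ≤ ∑ l, -(δ / 2) * |v l - θ| := by
        refine Finset.sum_le_sum fun l _ => ?_
        by_cases hl : l ∈ T
        · have hνl : ν l = -μ l := by simp [hν, hl]
          have h1 := hθT l hl
          have h2 := hμ l
          rw [abs_of_nonneg (by linarith), hνl, mul_comm]
          exact mul_le_mul_of_nonneg_right (by linarith) (by linarith)
        · have hνl : ν l = a / m - μ l := by simp [hν, hl]
          have h1 := hθ l hl
          have h2 := ha l
          rw [abs_of_nonpos (by linarith), hνl]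
          nlinarith
    _ = -(δ / 2) * ∑ l, |v l - θ| := by rw [Finset.mul_sum]
    _ ≤ -(δ / 2) * Real.sqrt (spread v) :=
        mul_le_mul_of_nonpos_left (sqrt_spread_le hn v θ) (by linarith)

end Spread

/-! ### One sampling period: bounded increments and mean increment -/

section Window

variable {n k d : ℕ} {law : PMF (ℕ × (Fin n → ℕ))} {ρ : ℝ}

theorem support_finite_of_le (hA : ∀ p ∈ law.support, (p.1 : ℝ) ≤ ρ)
    (hS : ∀ p ∈ law.support, ∀ l, (p.2 l : ℝ) ≤ ρ) : law.support.Finite := by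
  refine ((Set.finite_Iic ⌊ρ⌋₊).prod (Set.finite_Icc (0 : Fin n → ℕ) fun _ => ⌊ρ⌋₊)).subset
    fun p hp => ?_
  exact ⟨Nat.le_floor (hA p hp), fun l => (p.2 l).zero_le, fun l => Nat.le_floor (hS p hp l)⟩

theorem slot_support_finite (hlaw : law.support.Finite) (i : Fin n) (q : Fin n → ℕ) :
    (slot law i q).support.Finite := by
  rw [slot, PMF.support_map]
  exact hlaw.image _

theorem window_support_finite (hlaw : law.support.Finite) (hdn : d < n)
    (T : {T : Finset (Fin n) // T.card = d}) (q : Fin n → ℕ) (j : ℕ) :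
    (window law hdn T q j).support.Finite := by
  induction j with
  | zero => rw [window, PMF.support_pure]; exact Set.finite_singleton _
  | succ j ih => exact support_bind_finite ih fun q' => slot_support_finite hlaw _ q'

theorem abs_serve_sub_le {q s : Fin n → ℕ} {a : ℕ} (ha : (a : ℝ) ≤ ρ) (hs : ∀ l, (s l : ℝ) ≤ ρ)
    (i l : Fin n) : |(serve q i a s l : ℝ) - q l| ≤ ρ := by
  have hsl := hs l
  have h1 : serve q i a s l ≤ q l + a := by
    rw [serve]
    split_ifs <;> omega
  have h2 : q l ≤ serve q i a s l + s l := by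
    rw [serve]
    split_ifs <;> omega
  have h1' : (serve q i a s l : ℝ) ≤ q l + a := by exact_mod_cast h1
  have h2' : (q l : ℝ) ≤ serve q i a s l + s l := by exact_mod_cast h2
  rw [abs_le]
  constructor <;> linarith

theorem abs_sub_le_of_mem_slot (hA : ∀ p ∈ law.support, (p.1 : ℝ) ≤ ρ)
    (hS : ∀ p ∈ law.support, ∀ l, (p.2 l : ℝ) ≤ ρ) {i : Fin n} {q q' : Fin n → ℕ}
    (h : q' ∈ (slot law i q).support) (l : Fin n) : |(q' l : ℝ) - q l| ≤ ρ := by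
  rw [slot, PMF.mem_support_map_iff] at h
  obtain ⟨p, hp, rfl⟩ := h
  exact abs_serve_sub_le (hA p hp) (hS p hp) i l

theorem abs_sub_le_of_mem_window (hA : ∀ p ∈ law.support, (p.1 : ℝ) ≤ ρ)
    (hS : ∀ p ∈ law.support, ∀ l, (p.2 l : ℝ) ≤ ρ) (hdn : d < n)
    (T : {T : Finset (Fin n) // T.card = d}) (q : Fin n → ℕ) (j : ℕ) {q' : Fin n → ℕ}
    (h : q' ∈ (window law hdn T q j).support) (l : Fin n) : |(q' l : ℝ) - q l| ≤ j * ρ := by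
  induction j generalizing q' with
  | zero =>
    rw [window, PMF.mem_support_pure_iff] at h
    simp [h]
  | succ j ih =>
    rw [window, PMF.mem_support_bind_iff] at h
    obtain ⟨z, hz, hzq⟩ := h
    have h1 := ih hz
    have h2 := abs_sub_le_of_mem_slot hA hS hzq l
    have h3 := abs_sub_le (q' l : ℝ) (z l) (q l)
    push_cast
    linarith

theorem abs_sub_le_of_mem_iterStep (hA : ∀ p ∈ law.support, (p.1 : ℝ) ≤ ρ)
    (hS : ∀ p ∈ law.support, ∀ l, (p.2 l : ℝ) ≤ ρ) (hk : 1 ≤ k) (hdn : d < n) (j : ℕ)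
    {x y : State n k d} (h : y ∈ (iterStep (step hk hdn law) j x).support) (l : Fin n) :
    |(y.Q l : ℝ) - x.Q l| ≤ j * ρ := by
  induction j generalizing y with
  | zero =>
    rw [iterStep, PMF.mem_support_pure_iff] at h
    simp [h]
  | succ j ih =>
    rw [iterStep, PMF.mem_support_bind_iff] at h
    obtain ⟨z, hz, hzy⟩ := h
    have h1 := ih hz
    have hy : y.Q ∈ (slot law (route hdn z.Id z.phase) z.Q).support := by
      rw [← map_Q_step_mid law hk hdn z.Id z.phase_lt, State.mid_phase]
      exact (PMF.mem_support_map_iff _ _ _).2 ⟨y, hzy, rfl⟩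
    have h2 := abs_sub_le_of_mem_slot hA hS hy l
    have h3 := abs_sub_le (y.Q l : ℝ) (z.Q l) (x.Q l)
    push_cast
    linarith

/-- Service is wasted only if `q l` is less than `s l`, hence at most `ρ`. The weight of such a
short queue is at most `L` and the waste at most `ρ`, so the error is at most `L * ρ`. -/
theorem mul_serve_le {q s : Fin n → ℕ} {a : ℕ} (hs : ∀ l, (s l : ℝ) ≤ ρ) {L : ℝ} (hL : 0 ≤ L)
    {w : Fin n → ℝ} (hw : ∀ l, (q l : ℝ) ≤ ρ → w l ≤ L) (hρ : 0 ≤ ρ) (i l : Fin n) :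
    w l * serve q i a s l ≤
      w l * q l + (if l = i then w l * a else 0) - w l * s l + L * ρ := by
  have hsl := hs l
  set b : ℕ := if l = i then a else 0 with hb
  have hif : (if l = i then w l * (a : ℝ) else 0) = w l * b := by
    rw [hb]
    split_ifs <;> simp
  rw [hif, serve, ← hb]
  rcases le_total (s l) (q l + b) with h | h
  · rw [Nat.cast_sub h]
    push_cast
    nlinarith [mul_nonneg hL hρ]
  · rw [Nat.sub_eq_zero_of_le h]
    have h' : (q l : ℝ) + b ≤ s l := by exact_mod_cast h
    have hb0 : (0 : ℝ) ≤ b := b.cast_nonneg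
    have hq0 : (0 : ℝ) ≤ q l := (q l).cast_nonneg
    have h1 : w l * ((s l : ℝ) - q l - b) ≤ L * ρ :=
      (mul_le_mul_of_nonneg_right (hw l (by linarith)) (by linarith)).trans
        (mul_le_mul_of_nonneg_left (by linarith) hL)
    push_cast
    linarith

theorem expect_slot_le (hlaw : law.support.Finite) (hS : ∀ p ∈ law.support, ∀ l, (p.2 l : ℝ) ≤ ρ)
    (hρ : 0 ≤ ρ) {a : ℝ} {μ : Fin n → ℝ} (ha : expect law (fun p => (p.1 : ℝ)) = a)
    (hμ : ∀ l, expect law (fun p => (p.2 l : ℝ)) = μ l) {L : ℝ} (hL : 0 ≤ L) {q : Fin n → ℕ}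
    {w : Fin n → ℝ} (hw : ∀ l, (q l : ℝ) ≤ ρ → w l ≤ L) (i : Fin n) :
    expect (slot law i q) (fun q' => ∑ l, w l * q' l) ≤
      (∑ l, w l * q l) + a * w i - (∑ l, w l * μ l) + n * (L * ρ) := by
  rw [slot, expect_map hlaw]
  calc expect law (fun p => ∑ l, w l * (serve q i p.1 p.2 l : ℝ))
      ≤ expect law (fun p => ((∑ l, w l * q l) + n * (L * ρ)) +
          (w i * (p.1 : ℝ) + ∑ l, -w l * (p.2 l : ℝ))) := by
        refine expect_mono hlaw fun p hp => ?_
        refine (Finset.sum_le_sum fun l _ =>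
          mul_serve_le (a := p.1) (hS p hp) hL hw hρ i l).trans (le_of_eq ?_)
        simp only [Finset.sum_add_distrib, Finset.sum_sub_distrib, Finset.sum_ite_eq',
          Finset.mem_univ, if_true, Finset.sum_const, Finset.card_univ, Fintype.card_fin,
          nsmul_eq_mul, neg_mul, Finset.sum_neg_distrib]
        ring
    _ = _ := by
        rw [expect_add hlaw, expect_const, expect_add hlaw, expect_const_mul, ha,
          expect_sum hlaw]
        simp_rw [expect_const_mul, hμ, neg_mul, Finset.sum_neg_distrib]
        ring

/-- The weights stay fixed throughout the period and never exceed the initial queue lengths. A queue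
that is short at some slot was thus not long initially, which bounds its weight where service is
wasted. -/
theorem expect_window_le (hA : ∀ p ∈ law.support, (p.1 : ℝ) ≤ ρ)
    (hS : ∀ p ∈ law.support, ∀ l, (p.2 l : ℝ) ≤ ρ)
    (hρ : 0 ≤ ρ) {a : ℝ} {μ : Fin n → ℝ} (ha : expect law (fun p => (p.1 : ℝ)) = a)
    (hμ : ∀ l, expect law (fun p => (p.2 l : ℝ)) = μ l) (hdn : d < n)
    (T : {T : Finset (Fin n) // T.card = d}) {q : Fin n → ℕ} {w : Fin n → ℝ}
    (hw : ∀ l, w l ≤ q l) {N j : ℕ} (hj : j ≤ N) :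
    expect (window law hdn T q j) (fun q' => ∑ l, w l * q' l) ≤
      (∑ l, w l * q l) + a * (∑ i ∈ Finset.range j, w (route hdn T i)) - j * (∑ l, w l * μ l) +
        j * (n * (N * ρ * ρ)) := by
  have hlaw := support_finite_of_le hA hS
  induction j with
  | zero => simp [window, expect_pure]
  | succ j ih =>
    have hjN : (j : ℝ) + 1 ≤ N := by exact_mod_cast hj
    have hfin := window_support_finite hlaw hdn T q j
    rw [window, expect_bind hfin fun q' => slot_support_finite hlaw _ q']
    calc expect (window law hdn T q j) (fun q' =>
          expect (slot law (route hdn T j) q') fun q'' => ∑ l, w l * q'' l)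
        ≤ expect (window law hdn T q j) (fun q' => (∑ l, w l * q' l) +
          (a * w (route hdn T j) - (∑ l, w l * μ l) + n * (N * ρ * ρ))) := by
          refine expect_mono hfin fun q' hq' => ?_
          refine (expect_slot_le hlaw hS hρ ha hμ (L := N * ρ) (by positivity)
            (fun l hl => ?_) (route hdn T j)).trans (le_of_eq (by ring))
          -- A queue of length at most `ρ` after `j` slots had initially at most `(j + 1) * ρ ≤ N *
          -- ρ`.
          have h1 := (abs_le.1 (abs_sub_le_of_mem_window hA hS hdn T q j hq' l)).1
          have h2 := mul_le_mul_of_nonneg_right hjN hρ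
          linarith [hw l]
      _ ≤ _ := by
          rw [expect_add hfin, expect_const, Finset.sum_range_succ]
          have := ih (by omega)
          push_cast
          linarith

/-- A period consists of `k` complete rounds, each visiting every index outside `T` once. -/
theorem sum_route (hdn : d < n) (T : {T : Finset (Fin n) // T.card = d}) (w : Fin n → ℝ) (k : ℕ) :
    ∑ j ∈ Finset.range (k * (n - d)), w (route hdn T j) = k * ∑ l ∈ (T.1)ᶜ, w l := by
  induction k with
  | zero => simp
  | succ k ih =>
    have hround : ∑ j ∈ Finset.range (n - d), w (route hdn T (k * (n - d) + j)) =
        ∑ l ∈ (T.1)ᶜ, w l := by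
      have hc : (T.1)ᶜ.card = n - d := by rw [Finset.card_compl, Fintype.card_fin, T.2]
      rw [← Finset.image_orderEmbOfFin_univ _ hc, Finset.sum_image
        (fun a _ b _ h => ((T.1)ᶜ.orderEmbOfFin hc).injective h), Finset.sum_range]
      refine Finset.sum_congr rfl fun j _ => ?_
      have hj : (k * (n - d) + (j : ℕ)) % (n - d) = j := by
        rw [Nat.mul_add_mod_self_right, Nat.mod_eq_of_lt j.2]
      rw [route]
      congr 2
      exact Fin.ext hj
    rw [Nat.succ_mul, Finset.sum_range_add, ih, hround]
    push_cast
    ring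

theorem exists_threshold {T : Finset (Fin n)} (hT : T.Nonempty) {q : Fin n → ℕ}
    (h : ∀ i ∈ T, ∀ j ∉ T, q j ≤ q i) :
    ∃ θ : ℝ, (∀ i ∈ T, θ ≤ (q i : ℝ)) ∧ ∀ j ∉ T, (q j : ℝ) ≤ θ := by
  obtain ⟨i₀, hi₀, hmin⟩ := T.exists_min_image q hT
  exact ⟨q i₀, fun i hi => by exact_mod_cast hmin i hi, fun j hj => by exact_mod_cast h i₀ hi₀ j hj⟩

theorem cubic_bound {X B c : ℝ} (hX : 0 ≤ X) (hB : 0 ≤ B) (hc : 0 < c) :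
    B * X ^ 2 - c * X ^ 3 ≤ B ^ 3 / c ^ 2 := by
  rcases le_total (B / c) X with h | h
  · have h1 : B ≤ c * X := by rwa [div_le_iff₀' hc] at h
    have h2 : B * X ^ 2 ≤ c * X * X ^ 2 := mul_le_mul_of_nonneg_right h1 (sq_nonneg X)
    have h3 : 0 ≤ B ^ 3 / c ^ 2 := by positivity
    nlinarith
  · have h1 : X ^ 2 ≤ (B / c) ^ 2 := pow_le_pow_left₀ hX h 2
    have h2 : B * X ^ 2 ≤ B * (B / c) ^ 2 := mul_le_mul_of_nonneg_left h1 hB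
    have h3 : B * (B / c) ^ 2 = B ^ 3 / c ^ 2 := by
      rw [div_pow]
      ring
    have h4 : 0 ≤ c * X ^ 3 := by positivity
    linarith

end Window

/-! ### Drift of the fourth power and second moments -/

/-- The conditions on the law of one slot and on the rates that drive the state space collapse:
in mean, every queue outside the set of the `d` longest ones receives more than it serves. -/
structure Stabilizing {n : ℕ} (d : ℕ) (law : PMF (ℕ × (Fin n → ℕ))) (ρ δ : ℝ) : Prop where
  arrival_le : ∀ p ∈ law.support, (p.1 : ℝ) ≤ ρ
  service_le : ∀ p ∈ law.support, ∀ l, (p.2 l : ℝ) ≤ ρ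
  rates : ∃ (a μmin : ℝ) (μ : Fin n → ℝ), expect law (fun p => (p.1 : ℝ)) = a ∧
    (∀ l, expect law (fun p => (p.2 l : ℝ)) = μ l) ∧ δ ≤ μmin ∧ (∀ l, μmin ≤ μ l) ∧
    0 < (∑ l, μ l) - a ∧ (∑ l, μ l) - a ≤ μmin / 2 ∧ ∀ l, μ l + δ / 2 ≤ a / ((n : ℝ) - d)

section Drift

variable {n k d : ℕ} {law : PMF (ℕ × (Fin n → ℕ))} {ρ δ : ℝ}

/-- Where `15 * B` comes from: in units of `spread`, the second-order terms give `10 * B`, the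
wasted service `4 * B`, and the term on the left one more. The linear drift, multiplied by `4 *
spread`, becomes the cubic term with coefficient `2 * δ * K`, which `cubic_bound` plays against
them. -/
theorem expect_window_spread_sq_le (hst : Stabilizing d law ρ δ) (hδ : 0 < δ) (hρ : 0 ≤ ρ)
    (hk : 1 ≤ k) (hd : 1 ≤ d)
    (hdn : d < n) {q : Fin n → ℕ} {T : {T : Finset (Fin n) // T.card = d}}
    (hT : T ∈ longestSets d q) {K B : ℝ} (hK : K = k * ((n : ℝ) - d))
    (hB : B = n * (K * ρ) ^ 2) :
    expect (window law hdn T q (k * (n - d)))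
        (fun q' => spread (fun l => (q' l : ℝ)) ^ 2) + B * spread (fun l => (q l : ℝ)) ≤
      spread (fun l => (q l : ℝ)) ^ 2 +
        ((15 * B) ^ 3 / (2 * δ * K) ^ 2 + 2 * B ^ 2) := by
  obtain ⟨hA, hS, a, μmin, μ, ha, hμ, hδμ, hμmin, hε, hε', hgap⟩ := hst
  have hn : 0 < n := by omega
  have hm : (0 : ℝ) < (n : ℝ) - d := by
    have : (d : ℝ) < n := by exact_mod_cast hdn
    linarith
  have hKcast : ((k * (n - d) : ℕ) : ℝ) = K := by
    rw [hK, Nat.cast_mul, Nat.cast_sub hdn.le]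
  have hk' : (0 : ℝ) < k := by exact_mod_cast hk
  have hKpos : 0 < K := by rw [hK]; positivity
  have hfin := window_support_finite (support_finite_of_le hA hS) hdn T q (k * (n - d))
  have hTne : T.1.Nonempty := by
    rw [← Finset.card_pos, T.2]
    omega
  have hT' : ∀ i ∈ T.1, ∀ j ∉ T.1, q j ≤ q i := by simpa [longestSets] using hT
  obtain ⟨θ, hθT, hθ⟩ := exists_threshold hTne hT'
  set v : Fin n → ℝ := fun l => (q l : ℝ) with hv
  set w : Fin n → ℝ := fun l => v l - (∑ j, v j) / n with hw
  have hcard : (((T.1)ᶜ.card : ℕ) : ℝ) = (n : ℝ) - d := by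
    rw [Finset.card_compl, Fintype.card_fin, T.2, Nat.cast_sub hdn.le]
  have hinc := mean_increment_le hn hm hcard (v := v) hθT hθ hδμ hδ hμmin hε hε' hgap
  have hwin := expect_window_le hA hS hρ ha hμ hdn T (q := q) (w := w)
    (fun l => sub_le_self _ (by positivity)) (le_refl (k * (n - d)))
  rw [sum_route, hKcast] at hwin
  have hS0 := spread_nonneg v
  have hsq := Real.sq_sqrt hS0
  have hX0 := Real.sqrt_nonneg (spread v)
  set X := Real.sqrt (spread v) with hX
  have hlin : expect (window law hdn T q (k * (n - d))) (fun q' => ∑ l, w l * q' l) ≤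
      (∑ l, w l * q l) - K * (δ / 2) * X + B := by
    have h1 : a * (k * ∑ l ∈ (T.1)ᶜ, w l) - K * ∑ l, w l * μ l =
        K * ((a / ((n : ℝ) - d)) * (∑ l ∈ (T.1)ᶜ, w l) - ∑ l, w l * μ l) := by
      rw [hK]
      field_simp
    have h2 := mul_le_mul_of_nonneg_left hinc hKpos.le
    have h3 : K * (n * (K * ρ * ρ)) = B := by
      rw [hB]
      ring
    rw [h3] at hwin
    linarith
  have hpt : ∀ q' ∈ (window law hdn T q (k * (n - d))).support,
      spread (fun l => (q' l : ℝ)) ^ 2 ≤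
        (spread v ^ 2 + 10 * spread v * B + 2 * B ^ 2 - 4 * spread v * ∑ l, w l * q l) +
          4 * spread v * ∑ l, w l * q' l := by
    intro q' hq'
    have hd' : ∀ l, |(q' l : ℝ) - v l| ≤ K * ρ := fun l => by
      rw [← hKcast]
      exact abs_sub_le_of_mem_window hA hS hdn T q _ hq' l
    have h1 := spread_sq_add_le hn (v := v) (w := fun l => (q' l : ℝ) - v l) hd'
    simp only [add_sub_cancel, mul_sub, Finset.sum_sub_distrib] at h1
    rw [← hB] at h1
    linarith
  have hE := expect_mono hfin hpt
  rw [expect_add hfin, expect_const, expect_const_mul] at hE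
  have h4 := mul_le_mul_of_nonneg_left hlin (by positivity : 0 ≤ 4 * spread v)
  have hB0 : 0 ≤ B := by rw [hB]; positivity
  have hc := cubic_bound hX0 (by positivity : 0 ≤ 15 * B) (by positivity : 0 < 2 * δ * K)
  rw [← hsq] at hE h4 ⊢
  nlinarith

theorem perpSecondMoment_sampled_le (hst : Stabilizing d law ρ δ) (hδ : 0 < δ) (hρ : 0 < ρ)
    (hk : 1 ≤ k) (hd : 1 ≤ d) (hdn : d < n) {K B : ℝ} (hK : K = k * ((n : ℝ) - d))
    (hB : B = n * (K * ρ) ^ 2) {π : PMF (Fin n → ℕ)}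
    (hπ : IsStationary (sampledStep hk hdn law) π) :
    perpSecondMoment π id ≤ ENNReal.ofReal (844 * B ^ 2 / (δ * K) ^ 2 + 2 * B) := by
  have hm : (0 : ℝ) < (n : ℝ) - d := by
    have : (d : ℝ) < n := by exact_mod_cast hdn
    linarith
  have hn : (0 : ℝ) < n := by exact_mod_cast (by omega : 0 < n)
  have hk' : (0 : ℝ) < k := by exact_mod_cast hk
  have hKpos : 0 < K := by rw [hK]; positivity
  have hBpos : 0 < B := by rw [hB]; positivity
  set b : ℝ := (15 * B) ^ 3 / (2 * δ * K) ^ 2 + 2 * B ^ 2 with hb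
  have hb0 : 0 ≤ b := by positivity
  have hlaw := support_finite_of_le hst.arrival_le hst.service_le
  have hdrift := stationary_le_of_drift hπ
    (V := fun q => ENNReal.ofReal (spread (fun l => (q l : ℝ)) ^ 2))
    (f := fun q => ENNReal.ofReal (B * spread (fun l => (q l : ℝ)))) (b := ENNReal.ofReal b)
    (fun q => ENNReal.ofReal_ne_top) (fun q => by
      -- The drift bound holds for each admissible choice of the longest queues, so it survives
      -- averaging over the ties.
      rw [sampledStep_eq, tsum_bind_mul, ← tsum_mul_const (chooseLongest hdn q)
        (ENNReal.ofReal (B * spread fun l => (q l : ℝ))), ← ENNReal.tsum_add]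
      simp_rw [← mul_add]
      refine tsum_mul_le_of_le fun T hT => ?_
      have hT' : T ∈ longestSets d q := by
        rw [chooseLongest] at hT
        exact (PMF.mem_support_uniformOfFinset_iff _ _).1 hT
      have hS0 := spread_nonneg fun l => (q l : ℝ)
      rw [tsum_mul_ofReal (window_support_finite hlaw hdn T q _) fun q' => sq_nonneg _,
        ← ENNReal.ofReal_add, ← ENNReal.ofReal_add (sq_nonneg _) hb0]
      · exact ENNReal.ofReal_le_ofReal
          (expect_window_spread_sq_le hst hδ hρ.le hk hd hdn hT' hK hB)
      · rw [expect]
        exact tsum_nonneg fun q' => mul_nonneg ENNReal.toReal_nonneg (sq_nonneg _)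
      · positivity)
  have hB' : ENNReal.ofReal B ≠ 0 := by simpa using hBpos
  have hmul : ENNReal.ofReal B * perpSecondMoment π id ≤ ENNReal.ofReal b := by
    refine le_trans (le_of_eq ?_) hdrift
    rw [perpSecondMoment, ← ENNReal.tsum_mul_left]
    refine tsum_congr fun q => ?_
    rw [ENNReal.ofReal_mul hBpos.le, id, norm_perp_sq]
    ring
  rw [mul_comm, ← ENNReal.le_div_iff_mul_le (Or.inl hB') (Or.inl ENNReal.ofReal_ne_top),
    ← ENNReal.ofReal_div_of_pos hBpos] at hmul
  refine hmul.trans (ENNReal.ofReal_le_ofReal ?_)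
  -- `15 ^ 3 / 2 ^ 2 = 843.75`.
  have h1 : b / B = 843.75 * (B ^ 2 / (δ * K) ^ 2) + 2 * B := by
    rw [hb]
    field_simp
    ring
  rw [h1, mul_div_assoc]
  have h2 : 0 ≤ B ^ 2 / (δ * K) ^ 2 := by positivity
  linarith

theorem perpSecondMoment_le_nextSample (hA : ∀ p ∈ law.support, (p.1 : ℝ) ≤ ρ)
    (hS : ∀ p ∈ law.support, ∀ l, (p.2 l : ℝ) ≤ ρ) (hρ : 0 ≤ ρ) (hk : 1 ≤ k)
    (hdn : d < n) {K B : ℝ} (hK : K = k * ((n : ℝ) - d))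
    (hB : B = n * (K * ρ) ^ 2) (π : PMF (State n k d)) :
    perpSecondMoment π State.Q ≤
      2 * perpSecondMoment (π.bind (nextSample law hk hdn)) id + ENNReal.ofReal (2 * B) := by
  have hn : 0 < n := by omega
  have hKcast : ((k * (n - d) : ℕ) : ℝ) = K := by
    rw [hK, Nat.cast_mul, Nat.cast_sub hdn.le]
  have hB0 : 0 ≤ B := by rw [hB]; positivity
  rw [perpSecondMoment, perpSecondMoment, tsum_bind_mul, ← tsum_mul_const π
    (ENNReal.ofReal (2 * B)), ← ENNReal.tsum_mul_left, ← ENNReal.tsum_add]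
  refine ENNReal.tsum_le_tsum fun x => ?_
  rw [← mul_assoc, mul_comm 2, mul_assoc, ← mul_add]
  gcongr
  rw [← tsum_mul_const (nextSample law hk hdn x) (ENNReal.ofReal (2 * B)),
    ← ENNReal.tsum_mul_left, ← ENNReal.tsum_add,
    ← tsum_mul_const (nextSample law hk hdn x) (ENNReal.ofReal (‖perp x.Q‖ ^ 2))]
  simp_rw [← mul_assoc, mul_comm (2 : ℝ≥0∞), mul_assoc, ← mul_add]
  refine tsum_mul_mono fun q hq => ?_
  rw [nextSample, PMF.mem_support_map_iff] at hq
  obtain ⟨y, hy, rfl⟩ := hq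
  have hdist : ∀ l, |(x.Q l : ℝ) - y.Q l| ≤ K * ρ := fun l => by
    rw [abs_sub_comm]
    refine (abs_sub_le_of_mem_iterStep hA hS hk hdn _ hy l).trans ?_
    rw [← hKcast]
    exact mul_le_mul_of_nonneg_right (by exact_mod_cast Nat.sub_le _ _) hρ
  have h1 := spread_add_le hn (v := fun l => (y.Q l : ℝ))
    (w := fun l => (x.Q l : ℝ) - y.Q l) hdist
  simp only [add_sub_cancel] at h1
  rw [← hB] at h1
  have h2 : (2 : ℝ≥0∞) = ENNReal.ofReal 2 := by simp
  rw [id, norm_perp_sq, norm_perp_sq, h2, ← ENNReal.ofReal_mul zero_le_two,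
    ← ENNReal.ofReal_add (mul_nonneg zero_le_two (spread_nonneg _)) (by positivity)]
  exact ENNReal.ofReal_le_ofReal h1

/-- Since `n - d ≥ 1`, the slack `ε` lowers the arrival rate per receiving queue by at most half the
gap `G`; the other half still exceeds `μmax` by at least `δ / 2`. -/
theorem IsModel.stabilizing {Amax Smax lam μmin μmax : ℝ} {μ : Fin n → ℝ}
    (hmodel : IsModel law Amax Smax lam μ μmin μmax) (hd : d < n) (hA : Amax ≤ ρ / n)
    (hS : Smax ≤ ρ) (hε : 0 < (∑ l, μ l) - n * lam)
    (hε' : (∑ l, μ l) - n * lam ≤ min μmin (1 / ((n : ℝ) - d) * (∑ l, μ l) - μmax) / 2)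
    (hδ : δ ≤ min μmin (1 / ((n : ℝ) - d) * (∑ l, μ l) - μmax)) :
    Stabilizing d law ρ δ := by
  have hn : (0 : ℝ) < n := by exact_mod_cast (by omega : 0 < n)
  have hm : (1 : ℝ) ≤ (n : ℝ) - d := by
    have : (d : ℝ) + 1 ≤ n := by exact_mod_cast hd
    linarith
  refine ⟨fun p hp => (hmodel.arrival_le p hp).trans ?_,
    fun p hp l => (hmodel.service_le p hp l).trans hS, n * lam, μmin, μ,
    hmodel.arrival_mean.tsum_eq, fun l => (hmodel.service_mean l).tsum_eq,
    hδ.trans (min_le_left _ _), hmodel.μmin_le, hε, ?_, fun l => ?_⟩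
  · rwa [le_div_iff₀' hn] at hA
  · exact hε'.trans (div_le_div_of_nonneg_right (min_le_left _ _) zero_le_two)
  · set G := min μmin (1 / ((n : ℝ) - d) * (∑ l, μ l) - μmax) with hG
    have h1 : G ≤ 1 / ((n : ℝ) - d) * (∑ l, μ l) - μmax := min_le_right _ _
    have h2 : ((∑ l, μ l) - n * lam) / ((n : ℝ) - d) ≤ G / 2 :=
      (div_le_self hε.le hm).trans hε'
    have h3 : n * lam / ((n : ℝ) - d) = 1 / ((n : ℝ) - d) * (∑ l, μ l) -
        ((∑ l, μ l) - n * lam) / ((n : ℝ) - d) := by ring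
    have h4 := hmodel.le_μmax l
    rw [h3]
    linarith

end Drift

end SLQ

end

/-! ### Choice of the constants -/

theorem theorem2 (Amax Smax δ : ℝ) (hδ : 0 < δ) :
    ∃ N₂ : ℕ → ℕ → ℕ → ℝ,
      (∃ c C : ℝ, 0 < c ∧ 0 < C ∧ ∀ n k d : ℕ, 1 ≤ k → 1 ≤ d → d < n →
        c * ((n : ℝ) ^ 8 * ((n : ℝ) - d) ^ 2 * (k : ℝ) ^ 2) ≤ N₂ n k d ∧
        N₂ n k d ≤ C * ((n : ℝ) ^ 8 * ((n : ℝ) - d) ^ 2 * (k : ℝ) ^ 2)) ∧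
      ∀ (n k d : ℕ) (hk : 1 ≤ k) (_hd : 1 ≤ d) (hdn : d < n)
        (law : PMF (ℕ × (Fin n → ℕ))) (lam : ℝ) (μ : Fin n → ℝ) (μmin μmax : ℝ),
        SLQ.IsModel law Amax Smax lam μ μmin μmax →
        (d : ℝ) > n - ∑ l, (μ l / ⨆ j, μ j) →
        0 < (∑ l, μ l) - n * lam →
        (∑ l, μ l) - n * lam ≤ min μmin (1 / ((n : ℝ) - d) * (∑ l, μ l) - μmax) / 2 →
        δ ≤ min μmin (1 / ((n : ℝ) - d) * (∑ l, μ l) - μmax) →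
        (∀ π : PMF (Fin n → ℕ), SLQ.IsStationary (SLQ.sampledStep hk hdn law) π →
          SLQ.perpSecondMoment π id ≤ ENNReal.ofReal (N₂ n k d)) ∧
        (∀ π : PMF (SLQ.State n k d), SLQ.IsStationary (SLQ.step hk hdn law) π →
          SLQ.perpSecondMoment π SLQ.State.Q ≤ ENNReal.ofReal (N₂ n k d)) := by
  -- `n * R` serves as `ρ`: it dominates both `n * Amax` and `Smax`, and the `+ 1` makes it
  -- positive.
  set R : ℝ := |Amax| + |Smax| + 1 with hR
  have hRpos : 0 < R := by positivity
  have hAR : Amax ≤ R := by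
    have := le_abs_self Amax
    have := abs_nonneg Smax
    linarith
  have hSR : Smax ≤ R := by
    have := le_abs_self Smax
    have := abs_nonneg Amax
    linarith
  set C : ℝ := 1688 * R ^ 4 / δ ^ 2 + 6 * R ^ 2 with hC
  have hCpos : 0 < C := by positivity
  refine ⟨fun n k d => C * ((n : ℝ) ^ 8 * ((n : ℝ) - d) ^ 2 * (k : ℝ) ^ 2),
    ⟨C, C, hCpos, hCpos, fun n k d _ _ _ => ⟨le_rfl, le_rfl⟩⟩, ?_⟩
  intro n k d hk hd hdn law lam μ μmin μmax hmodel _ hε hε' hgap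
  have hn : (1 : ℝ) ≤ n := by exact_mod_cast (by omega : 1 ≤ n)
  have hn0 : (0 : ℝ) < n := by linarith
  have hm : (0 : ℝ) < (n : ℝ) - d := by
    have : (d : ℝ) < n := by exact_mod_cast hdn
    linarith
  have hk' : (0 : ℝ) < k := by exact_mod_cast hk
  obtain ⟨K, hK⟩ : ∃ K, K = (k : ℝ) * ((n : ℝ) - d) := ⟨_, rfl⟩
  have hKpos : 0 < K := by rw [hK]; positivity
  obtain ⟨B, hB⟩ : ∃ B, B = (n : ℝ) * (K * (n * R)) ^ 2 := ⟨_, rfl⟩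
  have hBpos : 0 < B := by rw [hB]; positivity
  have hρ : 0 < n * R := by positivity
  have hst : SLQ.Stabilizing d law (n * R) δ := hmodel.stabilizing hdn
    (by rwa [mul_div_cancel_left₀ _ hn0.ne'])
    (hSR.trans (le_mul_of_one_le_left hRpos.le hn)) hε hε' hgap
  have hsampled : ∀ π : PMF (Fin n → ℕ), SLQ.IsStationary (SLQ.sampledStep hk hdn law) π →
      SLQ.perpSecondMoment π id ≤ ENNReal.ofReal (844 * B ^ 2 / (δ * K) ^ 2 + 2 * B) :=
    fun π hπ => SLQ.perpSecondMoment_sampled_le hst hδ hρ hk hd hdn hK hB hπ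
  -- With `ρ = n * R`, `B² / K²` is of order `n⁶ K²` and `B` of order `n³ K²`, both within `n⁸ K²`.
  -- The bound for the full chain is the larger of the two, so it determines `C`.
  have hbound : 2 * (844 * B ^ 2 / (δ * K) ^ 2 + 2 * B) + 2 * B ≤
      C * ((n : ℝ) ^ 8 * ((n : ℝ) - d) ^ 2 * (k : ℝ) ^ 2) := by
    have h1 : (n : ℝ) ^ 8 * ((n : ℝ) - d) ^ 2 * (k : ℝ) ^ 2 = n ^ 8 * K ^ 2 := by
      rw [hK]
      ring
    have h2 : 2 * (844 * B ^ 2 / (δ * K) ^ 2 + 2 * B) + 2 * B =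
        1688 * R ^ 4 / δ ^ 2 * (n ^ 6 * K ^ 2) + 6 * R ^ 2 * (n ^ 3 * K ^ 2) := by
      rw [hB]
      field_simp
      ring
    have h3 : (n : ℝ) ^ 6 ≤ n ^ 8 := pow_le_pow_right₀ hn (by norm_num)
    have h4 : (n : ℝ) ^ 3 ≤ n ^ 8 := pow_le_pow_right₀ hn (by norm_num)
    rw [h1, h2, hC, add_mul]
    gcongr
  have hpos : 0 ≤ 844 * B ^ 2 / (δ * K) ^ 2 + 2 * B := by positivity
  refine ⟨fun π hπ => (hsampled π hπ).trans (ENNReal.ofReal_le_ofReal ?_), fun π hπ => ?_⟩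
  · linarith
  · refine (SLQ.perpSecondMoment_le_nextSample hst.arrival_le hst.service_le hρ.le hk hdn hK hB
      π).trans ?_
    refine le_trans ?_ (ENNReal.ofReal_le_ofReal hbound)
    rw [ENNReal.ofReal_add (by positivity) (by positivity),
      ENNReal.ofReal_mul (q := 844 * B ^ 2 / (δ * K) ^ 2 + 2 * B) zero_le_two,
      ENNReal.ofReal_ofNat]
    gcongr
    exact hsampled _ (SLQ.isStationary_nextSample law hk hdn hπ)
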